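/- A metric space $(Z,\rho')$ is a snowflake if there are $\alpha\in(0,1)$ and a metric $\rho$ on $Z$ such that $\rho'=\rho^{\alpha}$. Two metric spaces $(X,d)$ and $(Z,\rho')$ are biLipschitz equivalent if there are a surjective map $f\colon X\to Z$ and a constant $C\ge 1$ such that $C^{-1}d(x,x')\le \rho'(f(x),f(x'))\le C\,d(x,x')$ for all $x,x'\in X$. Let $(X,d)$ and $(Y,d')$ be two non-empty metric spaces, and let $X\times Y$ carry the product metric $$(d\times d')\big((x,y),(x',y')\big)=\sqrt{d(x,x')^2+d'(y,y')^2}.$$ Then $(X\times Y,d\times d')$ is biLipschitz equivalent to a snowflake if and only if both $(X,d)$ and $(Y,d')$ are biLipschitz equivalent to a snowflake. -/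

import Mathlib

universe u v

/-- A metric space `X` is an `α`-snowflake if its distance is the `α`-th power of some
metric `ρ` on the same set. -/
def IsAlphaSnowflake (α : ℝ) (X : Type u) [d : MetricSpace X] : Prop :=
  ∃ ρ : MetricSpace X, ∀ x y : X, @dist X d.toDist x y = (@dist X ρ.toDist x y) ^ α

/-- A metric space is a snowflake if it is an `α`-snowflake for some `α ∈ (0, 1)`. -/
def IsSnowflake (X : Type u) [MetricSpace X] : Prop :=
  ∃ α : ℝ, 0 < α ∧ α < 1 ∧ IsAlphaSnowflake α X

/-- A map `f` between metric spaces is biLipschitz if there is a constant `C ≥ 1` with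
`C⁻¹ d(x, x') ≤ d'(f x, f x') ≤ C d(x, x')` for all `x`, `x'`. -/
def IsBiLipschitz {X : Type u} {Y : Type v} [MetricSpace X] [MetricSpace Y] (f : X → Y) : Prop :=
  ∃ C : ℝ, 1 ≤ C ∧ ∀ x x' : X,
    C⁻¹ * dist x x' ≤ dist (f x) (f x') ∧ dist (f x) (f x') ≤ C * dist x x'

/-- Two metric spaces are biLipschitz equivalent if there is a surjective biLipschitz map from
one onto the other (such a map is a bijection with biLipschitz inverse, so that the relation is
symmetric). -/
def BiLipschitzEquivalent (X : Type u) (Y : Type v) [MetricSpace X] [MetricSpace Y] : Prop :=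
  ∃ f : X → Y, IsBiLipschitz f ∧ Function.Surjective f

/-- The metric space `X` is biLipschitz equivalent to a snowflake. The snowflake may be taken in
the universe of `X`, since it is in bijection with `X`. -/
def BiLipschitzEquivalentToSnowflake (X : Type u) [MetricSpace X] : Prop :=
  ∃ (Z : Type u) (_ : MetricSpace Z), IsSnowflake Z ∧ BiLipschitzEquivalent X Z

/-! Being biLipschitz to a snowflake is intrinsic: it means that some metric `r` on the space itself
has a power `r ^ α`, `0 < α < 1`, comparable to the distance. Such a gauge restricts to subspaces,
and each factor sits isometrically in the product as a slice. Conversely, a power of a metric with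
exponent at most `1` is a metric, so the gauges of the factors can be brought to a common exponent;
their maximum is then a gauge on the product, the Euclidean and maximum combinations being
comparable. -/

theorem withLp_two_prod_dist {X : Type u} {Y : Type v} [MetricSpace X] [MetricSpace Y]
    (p q : WithLp 2 (X × Y)) :
    dist p q = √(dist p.fst q.fst ^ 2 + dist p.snd q.snd ^ 2) := by
  rw [WithLp.prod_dist_eq_add (by norm_num), Real.sqrt_eq_rpow]
  simp

/-- `r` is a metric on `X`, given as a function, whose `α`-th power is comparable to the distance
of `X` with constant `C`. That `r` separates points follows from the lower bound. -/
structure IsSnowflakeGauge {X : Type u} [MetricSpace X] (α C : ℝ) (r : X → X → ℝ) : Prop where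
  one_le : 1 ≤ C
  self : ∀ x, r x x = 0
  symm : ∀ x y, r x y = r y x
  triangle : ∀ x y z, r x z ≤ r x y + r y z
  lower : ∀ x y, C⁻¹ * dist x y ≤ r x y ^ α
  upper : ∀ x y, r x y ^ α ≤ C * dist x y

namespace IsSnowflakeGauge

variable {X : Type u} {Y : Type v} [MetricSpace X] [MetricSpace Y] {α β C D : ℝ}
  {r : X → X → ℝ} {s : Y → Y → ℝ}

theorem nonneg (h : IsSnowflakeGauge α C r) (x y : X) : 0 ≤ r x y := by
  have h₁ := h.triangle x y x
  rw [h.self, h.symm y x] at h₁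
  linarith

theorem eq_of_eq_zero (h : IsSnowflakeGauge α C r) (hα : 0 < α) {x y : X} (hxy : r x y = 0) :
    x = y := by
  have h₁ := h.lower x y
  rw [hxy, Real.zero_rpow hα.ne'] at h₁
  have hC : 0 < C⁻¹ := inv_pos.2 (zero_lt_one.trans_le h.one_le)
  exact dist_le_zero.1 (nonpos_of_mul_nonpos_right h₁ hC)

/-- On `[0, ∞)` the function `t ↦ t ^ β` is monotone and subadditive. -/
theorem rpow_triangle (h : IsSnowflakeGauge α C r) (hβ : 0 ≤ β) (hβ' : β ≤ 1) (x y z : X) :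
    r x z ^ β ≤ r x y ^ β + r y z ^ β :=
  (Real.rpow_le_rpow (h.nonneg x z) (h.triangle x y z) hβ).trans
    (Real.rpow_add_le_add_rpow (h.nonneg x y) (h.nonneg y z) hβ hβ')

/-- The exponent of a gauge can be increased. -/
theorem exponent_mono (h : IsSnowflakeGauge α C r) (hα : 0 < α) (hαβ : α ≤ β) :
    IsSnowflakeGauge β C (fun x y ↦ r x y ^ (α / β)) := by
  have hβ : 0 < β := hα.trans_le hαβ
  have key (x y : X) : (r x y ^ (α / β)) ^ β = r x y ^ α := by
    rw [← Real.rpow_mul (h.nonneg x y), div_mul_cancel₀ _ hβ.ne']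
  refine ⟨h.one_le, fun x ↦ ?_, fun x y ↦ ?_,
    h.rpow_triangle (by positivity) ((div_le_one hβ).2 hαβ), fun x y ↦ ?_, fun x y ↦ ?_⟩
  · simp only [h.self]
    exact Real.zero_rpow (by positivity)
  · simp only [h.symm x y]
  · simpa only [key] using h.lower x y
  · simpa only [key] using h.upper x y

theorem const_mono (h : IsSnowflakeGauge α C r) (hCD : C ≤ D) : IsSnowflakeGauge α D r where
  one_le := h.one_le.trans hCD
  self := h.self
  symm := h.symm
  triangle := h.triangle
  lower x y := (mul_le_mul_of_nonneg_right
    (inv_anti₀ (zero_lt_one.trans_le h.one_le) hCD) dist_nonneg).trans (h.lower x y)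
  upper x y := (h.upper x y).trans (mul_le_mul_of_nonneg_right hCD dist_nonneg)

theorem comp_isometry (h : IsSnowflakeGauge β D s) {f : X → Y} (hf : Isometry f) :
    IsSnowflakeGauge β D (fun x y ↦ s (f x) (f y)) where
  one_le := h.one_le
  self x := h.self (f x)
  symm x y := h.symm (f x) (f y)
  triangle x y z := h.triangle (f x) (f y) (f z)
  lower x y := hf.dist_eq x y ▸ h.lower (f x) (f y)
  upper x y := hf.dist_eq x y ▸ h.upper (f x) (f y)

/-- The maximum of two gauges with the same exponent is a gauge on the product. -/
theorem prod (h : IsSnowflakeGauge α C r) (h' : IsSnowflakeGauge α C s) (hα : 0 < α) :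
    IsSnowflakeGauge (X := WithLp 2 (X × Y)) α (2 * C)
      (fun p q ↦ max (r p.fst q.fst) (s p.snd q.snd)) := by
  have hC : 0 < C := zero_lt_one.trans_le h.one_le
  have key (p q : WithLp 2 (X × Y)) : max (r p.fst q.fst) (s p.snd q.snd) ^ α =
      max (r p.fst q.fst ^ α) (s p.snd q.snd ^ α) :=
    (Real.monotoneOn_rpow_Ici_of_exponent_nonneg hα.le).map_max
      (h.nonneg _ _) (h'.nonneg _ _)
  refine ⟨by linarith [h.one_le], fun p ↦ by simp [h.self, h'.self], fun p q ↦ ?_,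
    fun p q t ↦ max_le ?_ ?_, fun p q ↦ ?_, fun p q ↦ ?_⟩
  · simp only [h.symm p.fst, h'.symm p.snd]
  · exact (h.triangle _ q.fst _).trans (add_le_add (le_max_left _ _) (le_max_left _ _))
  · exact (h'.triangle _ q.snd _).trans (add_le_add (le_max_right _ _) (le_max_right _ _))
  · rw [key, withLp_two_prod_dist]
    have h₁ := h.lower p.fst q.fst
    have h₂ := h'.lower p.snd q.snd
    -- The sum is at most twice the maximum, whence the factor `2` in the constant.
    have h₃ : √(dist p.fst q.fst ^ 2 + dist p.snd q.snd ^ 2) ≤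
        dist p.fst q.fst + dist p.snd q.snd :=
      Real.sqrt_le_iff.2 ⟨by positivity, by
        nlinarith [mul_nonneg (dist_nonneg (x := p.fst) (y := q.fst))
          (dist_nonneg (x := p.snd) (y := q.snd))]⟩
    calc (2 * C)⁻¹ * √(dist p.fst q.fst ^ 2 + dist p.snd q.snd ^ 2)
        ≤ (2 * C)⁻¹ * (dist p.fst q.fst + dist p.snd q.snd) := by gcongr
      _ = (C⁻¹ * dist p.fst q.fst + C⁻¹ * dist p.snd q.snd) / 2 := by
        rw [mul_inv]; ring
      _ ≤ max (r p.fst q.fst ^ α) (s p.snd q.snd ^ α) := by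
        linarith [le_max_left (r p.fst q.fst ^ α) (s p.snd q.snd ^ α),
          le_max_right (r p.fst q.fst ^ α) (s p.snd q.snd ^ α)]
  · rw [key, withLp_two_prod_dist]
    have h₁ : dist p.fst q.fst ≤ √(dist p.fst q.fst ^ 2 + dist p.snd q.snd ^ 2) :=
      Real.le_sqrt_of_sq_le (by nlinarith [sq_nonneg (dist p.snd q.snd)])
    have h₂ : dist p.snd q.snd ≤ √(dist p.fst q.fst ^ 2 + dist p.snd q.snd ^ 2) :=
      Real.le_sqrt_of_sq_le (by nlinarith [sq_nonneg (dist p.fst q.fst)])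
    have hC₂ : C ≤ 2 * C := by linarith
    refine max_le ((h.upper _ _).trans ?_) ((h'.upper _ _).trans ?_) <;> gcongr

/-- The metric of which a gauge is the distance function. -/
abbrev metricSpace (h : IsSnowflakeGauge α C r) (hα : 0 < α) : MetricSpace X where
  dist := r
  dist_self := h.self
  dist_comm := h.symm
  dist_triangle := h.triangle
  eq_of_dist_eq_zero := h.eq_of_eq_zero hα

/-- The snowflake metric `r ^ α` of a gauge `r`. -/
noncomputable abbrev snowflakeMetricSpace (h : IsSnowflakeGauge α C r) (hα : 0 < α) (hα' : α ≤ 1) :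
    MetricSpace X where
  dist x y := r x y ^ α
  dist_self x := by rw [h.self, Real.zero_rpow hα.ne']
  dist_comm x y := by rw [h.symm]
  dist_triangle := h.rpow_triangle hα.le hα'
  eq_of_dist_eq_zero {x y} hxy :=
    h.eq_of_eq_zero hα ((Real.rpow_eq_zero (h.nonneg x y) hα.ne').1 hxy)

end IsSnowflakeGauge

/-- A snowflake structure on the target pulls back along the biLipschitz map; conversely, `r ^ α` is
a snowflake metric on `X`, and the identity is biLipschitz onto it. -/
theorem biLipschitzEquivalentToSnowflake_iff_gauge (X : Type u) [MetricSpace X] :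
    BiLipschitzEquivalentToSnowflake X ↔
      ∃ (α C : ℝ) (r : X → X → ℝ), 0 < α ∧ α < 1 ∧ IsSnowflakeGauge α C r := by
  constructor
  · rintro ⟨Z, _, ⟨α, hα, hα', ρ, hρ⟩, f, ⟨C, hC, hf⟩, -⟩
    refine ⟨α, C, fun x y ↦ ρ.dist (f x) (f y), hα, hα', hC, fun x ↦ ρ.dist_self _,
      fun x y ↦ ρ.dist_comm _ _, fun x y z ↦ ρ.dist_triangle _ _ _, fun x y ↦ ?_, fun x y ↦ ?_⟩
    · exact hρ (f x) (f y) ▸ (hf x y).1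
    · exact hρ (f x) (f y) ▸ (hf x y).2
  · rintro ⟨α, C, r, hα, hα', h⟩
    exact ⟨X, h.snowflakeMetricSpace hα hα'.le,
      ⟨α, hα, hα', h.metricSpace hα, fun _ _ ↦ rfl⟩,
      id, ⟨C, h.one_le, fun x y ↦ ⟨h.lower x y, h.upper x y⟩⟩, Function.surjective_id⟩

theorem BiLipschitzEquivalentToSnowflake.of_isometry {X : Type u} {Y : Type v} [MetricSpace X]
    [MetricSpace Y] (h : BiLipschitzEquivalentToSnowflake Y) {f : X → Y} (hf : Isometry f) :
    BiLipschitzEquivalentToSnowflake X := by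
  obtain ⟨α, C, r, hα, hα', hr⟩ := (biLipschitzEquivalentToSnowflake_iff_gauge Y).1 h
  exact (biLipschitzEquivalentToSnowflake_iff_gauge X).2 ⟨α, C, _, hα, hα', hr.comp_isometry hf⟩

/-- `WithLp 2 (X × Y)` is the product `X × Y` with the product metric
`d((x, y), (x', y')) = (d(x, x') ^ 2 + d(y, y') ^ 2) ^ (1 / 2)`. -/
theorem mainTheorem6 (X : Type u) (Y : Type v) [MetricSpace X] [MetricSpace Y]
    [Nonempty X] [Nonempty Y] :
    BiLipschitzEquivalentToSnowflake (WithLp 2 (X × Y)) ↔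
      BiLipschitzEquivalentToSnowflake X ∧ BiLipschitzEquivalentToSnowflake Y := by
  constructor
  · intro h
    obtain ⟨x₀⟩ := ‹Nonempty X›
    obtain ⟨y₀⟩ := ‹Nonempty Y›
    exact ⟨h.of_isometry (f := fun x ↦ WithLp.toLp 2 (x, y₀))
        (Isometry.of_dist_eq fun x x' ↦ by simp [withLp_two_prod_dist]),
      h.of_isometry (f := fun y ↦ WithLp.toLp 2 (x₀, y))
        (Isometry.of_dist_eq fun y y' ↦ by simp [withLp_two_prod_dist])⟩
  · rintro ⟨hX, hY⟩
    obtain ⟨α, C, r, hα, hα', hr⟩ := (biLipschitzEquivalentToSnowflake_iff_gauge X).1 hX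
    obtain ⟨β, D, s, hβ, hβ', hs⟩ := (biLipschitzEquivalentToSnowflake_iff_gauge Y).1 hY
    exact (biLipschitzEquivalentToSnowflake_iff_gauge _).2
      -- The larger exponent is still below `1`. Passing to the smaller one would raise a metric to
      -- a power above `1`, which can break the triangle inequality.
      ⟨max α β, 2 * max C D, _, lt_max_of_lt_left hα, max_lt hα' hβ',
        ((hr.exponent_mono hα (le_max_left α β)).const_mono (le_max_left C D)).prod
          ((hs.exponent_mono hβ (le_max_right α β)).const_mono (le_max_right C D))
          (lt_max_of_lt_left hα)⟩
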